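/- Let $n\ge 0$. A *rectifiable curve* in $\mathbb{R}^n$ is the image $\gamma([0,1])$ of a Lipschitz map $\gamma:[0,1]\to\mathbb{R}^n$ (constant maps allowed). For $A\subset\mathbb{R}^n$ and $r>0$ let $B(A,r)=\{x:\mathrm{dist}(x,A)\le r\}$ be the closed $r$-neighborhood (with $B(\varnothing,r)=\varnothing$), let $\mathcal{H}^1$ be the $1$-dimensional Hausdorff measure and $d_H$ the Hausdorff distance. An *$r$-maximum distance minimizer* of a set $F\subset\mathbb{R}^n$ is a rectifiable curve $\Gamma$ with $B(\Gamma,r)\supset F$ and $$\mathcal{H}^1(\Gamma)=\inf\{\mathcal{H}^1(\Gamma') : \Gamma' \text{ is a rectifiable curve and } B(\Gamma',r)\supset F\}.$$ **Theorem.** Let $E\subset\mathbb{R}^n$ be contained in a rectifiable curve and let $r_j>0$, $r_j\to 0$. Then there is a sequence $(\Gamma^*_{r_j})_j$, where $\Gamma^*_{r_j}$ is an $r_j$-maximum distance minimizer of $B(E,r_j)$ for every $j$, such that: 1. $\displaystyle\lim_{j\to\infty}\mathcal{H}^1(\Gamma^*_{r_j})=\inf\{\mathcal{H}^1(\Gamma):\Gamma\text{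 is a rectifiable curve},\ \Gamma\supset E\}$ (along the whole sequence); 2. every subsequence of $(\Gamma^*_{r_j})_j$ has a further subsequence that converges in Hausdorff distance to some rectifiable curve $\Gamma^*_0\supset E$ with $\mathcal{H}^1(\Gamma^*_0)=\inf\{\mathcal{H}^1(\Gamma):\Gamma\text{ is a rectifiable curve},\ \Gamma\supset E\}$; that is, $\Gamma^*_0$ solves the Analyst's Traveling Salesman Problem for $E$. In particular (starting from the whole sequence) such a $\Gamma^*_0$ exists. -/

import Mathlib

open Filter Topology MeasureTheory Metric Set
open scoped ENNReal NNReal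

noncomputable section

/-- A rectifiable curve in `ℝⁿ`, regarded as a set: the image of the unit interval under a Lipschitz
map (equivalently, by arc-length parametrization, under a continuous map of finite length).
Constant maps are allowed, so single points count as (degenerate) curves. -/
def IsRectifiableCurve {n : ℕ} (Γ : Set (EuclideanSpace ℝ (Fin n))) : Prop :=
  ∃ (γ : ℝ → EuclideanSpace ℝ (Fin n)) (K : ℝ≥0),
    LipschitzOnWith K γ (Icc (0 : ℝ) 1) ∧ Γ = γ '' Icc (0 : ℝ) 1

/-- `Λ(E, r)`: the infimum of `ℋ¹(Γ)` over the rectifiable curves `Γ` whose closed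
`r`-neighborhood contains `E`. -/
def maxDistInf {n : ℕ} (E : Set (EuclideanSpace ℝ (Fin n))) (r : ℝ) : ℝ≥0∞ :=
  sInf {ℓ | ∃ Γ : Set (EuclideanSpace ℝ (Fin n)),
    IsRectifiableCurve Γ ∧ E ⊆ cthickening r Γ ∧ ℓ = μH[1] Γ}

/-- `Γ` is an `r`-maximum distance minimizer of `E`. -/
def IsMaxDistMinimizer {n : ℕ} (E : Set (EuclideanSpace ℝ (Fin n))) (r : ℝ)
    (Γ : Set (EuclideanSpace ℝ (Fin n))) : Prop :=
  IsRectifiableCurve Γ ∧ E ⊆ cthickening r Γ ∧ μH[1] Γ = maxDistInf E r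

/-- The infimum of `ℋ¹(Γ)` over the rectifiable curves `Γ` containing `E`. -/
def travelingSalesmanInf {n : ℕ} (E : Set (EuclideanSpace ℝ (Fin n))) : ℝ≥0∞ :=
  sInf {ℓ | ∃ Γ : Set (EuclideanSpace ℝ (Fin n)),
    IsRectifiableCurve Γ ∧ E ⊆ Γ ∧ ℓ = μH[1] Γ}

end

/-! A curve containing `E` has an `r`-neighborhood containing that of `E`, so the minimizers are no
longer than the traveling salesman infimum. By the compactness theorem
`IsRectifiableCurve.exists_subseq_tendsto`, a subsequence converges to a curve no longer than the
liminf of the lengths. Since `r j → 0`, this limit contains `E`, so its length is at least the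
infimum; everything is squeezed to equality. The same compactness at fixed radius gives existence of
minimizers.

Compactness has three ingredients: Blaschke selection, the fact that a Hausdorff limit of curves of
bounded length is again a Lipschitz image (`exists_lipschitz_parametrization_of_tendsto`), and
Gołąb's semicontinuity of length (`hausdorffMeasure_le_liminf_of_tendsto_hausdorffEDist`).
Semicontinuity is local: near almost every point the limit looks like a segment, and a nearby
continuum must have almost the length of that segment. -/

/-! ### Lower length bounds for connected sets -/

/-- The 1-Lipschitz function "distance to `p`" maps `C` onto a set containing an interval of length
`dist q p`. -/
theorem edist_le_hausdorffMeasure_of_isPreconnected {X : Type*} [MetricSpace X] [MeasurableSpace X]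
    [BorelSpace X] {C : Set X} (hC : IsPreconnected C) {p q : X} (hp : p ∈ C) (hq : q ∈ C) :
    edist p q ≤ μH[1] C := by
  have hf : LipschitzWith 1 (fun z : X => dist z p) := LipschitzWith.dist_left p
  have h1 : Icc (dist p p) (dist q p) ⊆ (fun z : X => dist z p) '' C :=
    hC.intermediate_value hp hq hf.continuous.continuousOn
  have h2 := measure_mono (μ := μH[1]) h1
  have h3 := (hf.lipschitzOnWith (s := C)).hausdorffMeasure_image_le (d := 1) zero_le_one
  rw [hausdorffMeasure_real, Real.volume_Icc, dist_self, sub_zero] at h2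
  rw [hausdorffMeasure_real] at h3
  simp only [ENNReal.coe_one, ENNReal.one_rpow, one_mul] at h3
  rw [edist_comm, edist_dist]
  exact h2.trans h3

theorem exists_first_hit {f : ℝ → ℝ} (hf : ContinuousOn f (Icc 0 1)) {ρ : ℝ} (h0 : f 0 ≤ ρ)
    (h1 : ρ ≤ f 1) : ∃ s ∈ Icc (0 : ℝ) 1, f s = ρ ∧ ∀ u ∈ Icc 0 s, f u ≤ ρ := by
  have hcl : IsCompact (Icc (0 : ℝ) 1 ∩ f ⁻¹' Ici ρ) :=
    isCompact_Icc.of_isClosed_subset (hf.preimage_isClosed_of_isClosed isClosed_Icc isClosed_Ici)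
      inter_subset_left
  obtain ⟨s, ⟨hs, hs'⟩, hleast⟩ := hcl.exists_isLeast ⟨1, ⟨by simp, h1⟩⟩
  have hlt : ∀ u ∈ Icc 0 s, f u < ρ ∨ u = s := fun u hu => by
    by_contra! hc
    exact hc.2 (le_antisymm hu.2 (hleast ⟨⟨hu.1, hu.2.trans hs.2⟩, hc.1⟩))
  have hfs : f s = ρ := by
    obtain ⟨u, hu, hfu⟩ := intermediate_value_Icc hs.1
      (hf.mono (Icc_subset_Icc_right hs.2)) ⟨h0, hs'⟩
    rcases hlt u hu with h | rfl
    · exact absurd hfu h.ne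
    · exact hfu
  exact ⟨s, hs, hfs, fun u hu => (hlt u hu).elim le_of_lt fun h => (h ▸ hfs).le⟩

/-- Follow the curve from `p` towards the outside point: up to the first hit of the sphere, the arc
stays in the ball and is connected. -/
theorem exists_mem_connectedComponentIn_dist_eq {X : Type*} [MetricSpace X] {γ : ℝ → X}
    (hγ : ContinuousOn γ (Icc 0 1)) {x p : X} {ρ : ℝ} (hp : p ∈ γ '' Icc 0 1)
    (hpx : dist p x ≤ ρ) (hout : ∃ z ∈ γ '' Icc 0 1, ρ ≤ dist z x) :
    ∃ w ∈ connectedComponentIn (γ '' Icc 0 1 ∩ closedBall x ρ) p, dist w x = ρ := by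
  obtain ⟨a, ha, rfl⟩ := hp
  obtain ⟨_, ⟨b, hb, rfl⟩, hz⟩ := hout
  have hmem : ∀ s ∈ Icc (0 : ℝ) 1, a + s * (b - a) ∈ Icc (0 : ℝ) 1 := fun s hs =>
    ⟨by nlinarith [ha.1, hb.1, hs.1, hs.2], by nlinarith [ha.2, hb.2, hs.1, hs.2]⟩
  have hh : ContinuousOn (fun s => γ (a + s * (b - a))) (Icc (0 : ℝ) 1) :=
    hγ.comp (by fun_prop) hmem
  obtain ⟨s, hs, hfs, hle⟩ := exists_first_hit (f := fun s => dist (γ (a + s * (b - a))) x)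
    ((LipschitzWith.dist_left x).continuous.comp_continuousOn hh) (by simpa using hpx) (by simpa using hz)
  have hconn : IsPreconnected ((fun s => γ (a + s * (b - a))) '' Icc 0 s) :=
    isPreconnected_Icc.image _ (hh.mono (Icc_subset_Icc_right hs.2))
  refine ⟨_, hconn.subset_connectedComponentIn ⟨0, ⟨le_rfl, hs.1⟩, by simp⟩ ?_
    ⟨s, ⟨hs.1, le_rfl⟩, rfl⟩, hfs⟩
  rintro _ ⟨u, hu, rfl⟩
  exact ⟨mem_image_of_mem _ (hmem u ⟨hu.1, hu.2.trans hs.2⟩), hle u hu⟩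

theorem ofReal_sub_dist_le_hausdorffMeasure_component {X : Type*} [MetricSpace X]
    [MeasurableSpace X] [BorelSpace X] {γ : ℝ → X}
    (hγ : ContinuousOn γ (Icc 0 1)) {x p : X} {ρ : ℝ} (hp : p ∈ γ '' Icc 0 1)
    (hpx : dist p x ≤ ρ) (hout : ∃ z ∈ γ '' Icc 0 1, ρ ≤ dist z x) :
    ENNReal.ofReal (ρ - dist p x) ≤
      μH[1] (connectedComponentIn (γ '' Icc 0 1 ∩ closedBall x ρ) p) := by
  obtain ⟨w, hw, hwx⟩ := exists_mem_connectedComponentIn_dist_eq hγ hp hpx hout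
  refine le_trans ?_ (edist_le_hausdorffMeasure_of_isPreconnected
    isPreconnected_connectedComponentIn (mem_connectedComponentIn ⟨hp, hpx⟩) hw)
  rw [edist_dist]
  refine ENNReal.ofReal_le_ofReal ?_
  have := dist_triangle w p x
  rw [dist_comm w p] at this
  linarith

theorem isClosed_connectedComponentIn_of_isClosed {X : Type*} [TopologicalSpace X] {F : Set X}
    (hF : IsClosed F) (x : X) : IsClosed (connectedComponentIn F x) := by
  by_cases hx : x ∈ F
  · rw [connectedComponentIn_eq_image hx]
    exact hF.isClosedEmbedding_subtypeVal.isClosedMap _ isClosed_connectedComponent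
  · rw [connectedComponentIn_eq_empty hx]
    exact isClosed_empty

theorem disjoint_connectedComponentIn_of_ne {X : Type*} [TopologicalSpace X] {F : Set X} {x y : X}
    (h : connectedComponentIn F x ≠ connectedComponentIn F y) :
    Disjoint (connectedComponentIn F x) (connectedComponentIn F y) := by
  rw [Set.disjoint_left]
  exact fun z hx hy => h ((connectedComponentIn_eq hx).trans (connectedComponentIn_eq hy).symm)

/-- The trace of the curve in the ball may be disconnected, so lengths are counted by components.
Let `τ` and `σ` bound how far along each half of the diameter one finds components that also meet
the other half. Just beyond them a component belongs to one half only and runs to the sphere, giving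
lengths about `ρ - τ` and `ρ - σ`; the components joining the halves give about `τ + σ`. These
pieces are disjoint. -/
theorem ofReal_two_mul_sub_le_hausdorffMeasure_inter_closedBall {V : Type*} [NormedAddCommGroup V]
    [NormedSpace ℝ V] [MeasurableSpace V] [BorelSpace V] {γ : ℝ → V}
    (hγ : ContinuousOn γ (Icc 0 1)) {x u : V} (hu : ‖u‖ = 1) {ρ η : ℝ} (hη : 0 < η) (hηρ : η < ρ)
    (hnear : ∀ s ∈ Icc (-ρ) ρ, ∃ q ∈ γ '' Icc 0 1, dist q (x + s • u) < η)
    (hout : ∃ z ∈ γ '' Icc 0 1, ρ ≤ dist z x) :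
    ENNReal.ofReal (2 * ρ - 10 * η) ≤ μH[1] (γ '' Icc 0 1 ∩ closedBall x ρ) := by
  -- For `|s| ≤ R` the approximating point `q s` is still in the closed ball of radius `ρ`.
  set R := ρ - η with hR
  set F := γ '' Icc 0 1 ∩ closedBall x ρ with hF
  have hFc : IsClosed F := (isCompact_Icc.image_of_continuousOn hγ).isClosed.inter isClosed_closedBall
  choose! q hqK hq using hnear
  have hmem : ∀ s, |s| ≤ R → s ∈ Icc (-ρ) ρ := fun s hs =>
    ⟨by linarith [neg_abs_le s], by linarith [le_abs_self s]⟩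
  have hqx : ∀ s, |s| ≤ R → dist (q s) x ≤ |s| + η := fun s hs => by
    have h1 := hq s (hmem s hs)
    have h2 := dist_triangle (q s) (x + s • u) x
    have h3 : dist (x + s • u) x = |s| := by simp [dist_eq_norm, norm_smul, hu]
    linarith
  have hqF : ∀ s, |s| ≤ R → q s ∈ F := fun s hs =>
    ⟨hqK s (hmem s hs), mem_closedBall.2 (by linarith [hqx s hs])⟩
  have hqq : ∀ s t, |s| ≤ R → |t| ≤ R → |s - t| - 2 * η ≤ dist (q s) (q t) := fun s t hs ht => by
    have h1 := hq s (hmem s hs)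
    have h2 := hq t (hmem t ht)
    have h3 : dist (x + s • u) (x + t • u) = |s - t| := by
      simp [dist_eq_norm, ← sub_smul, norm_smul, hu]
    have h4 := dist_triangle4 (x + s • u) (q s) (q t) (x + t • u)
    rw [dist_comm _ (q s)] at h4
    linarith
  set c : ℝ → Set V := fun s => connectedComponentIn F (q s) with hc
  have hcF : ∀ s, c s ⊆ F := fun s => connectedComponentIn_subset _ _
  have hcc : ∀ s, IsClosed (c s) := fun s => isClosed_connectedComponentIn_of_isClosed hFc _
  have hcd : ∀ s t, c s ≠ c t → Disjoint (c s) (c t) := fun s t h =>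
    disjoint_connectedComponentIn_of_ne h
  have hcm : ∀ s t, |s| ≤ R → |t| ≤ R → c s = c t →
      ENNReal.ofReal (|s - t| - 2 * η) ≤ μH[1] (c s) := fun s t hs ht h => by
    refine (ENNReal.ofReal_le_ofReal (hqq s t hs ht)).trans ?_
    rw [← edist_dist]
    refine edist_le_hausdorffMeasure_of_isPreconnected isPreconnected_connectedComponentIn
      (mem_connectedComponentIn (hqF s hs)) ?_
    change q t ∈ c s
    rw [h]
    exact mem_connectedComponentIn (hqF t ht)
  have habs : ∀ e : ℝ, |e| = 1 → ∀ t ∈ Icc 0 R, |e * t| ≤ R := fun e he t ht => by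
    rw [abs_mul, he, one_mul, abs_of_nonneg ht.1]; exact ht.2
  have hR0 : 0 < R := by linarith
  have side : ∀ e : ℝ, |e| = 1 → ∃ τ ∈ Icc 0 R,
      (∃ t ∈ Icc 0 R, ∃ s ∈ Icc 0 R, τ - η < t ∧ c (e * t) = c (-e * s)) ∧
      ∃ A : Set V, IsClosed A ∧ A ⊆ F ∧ ENNReal.ofReal (ρ - τ - 2 * η) ≤ μH[1] A ∧
        (A = ∅ ∨ ∃ t ∈ Icc 0 R, A = c (e * t)) ∧ ∀ s ∈ Icc 0 R, Disjoint A (c (-e * s)) := by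
    intro e he
    set P := {t | t ∈ Icc 0 R ∧ ∃ s ∈ Icc 0 R, c (e * t) = c (-e * s)} with hP
    have h0 : (0 : ℝ) ∈ P := ⟨⟨le_rfl, hR0.le⟩, 0, ⟨le_rfl, hR0.le⟩, by simp⟩
    have hb : BddAbove P := ⟨R, fun t ht => ht.1.2⟩
    have hτ : sSup P ∈ Icc 0 R := ⟨le_csSup hb h0, csSup_le ⟨0, h0⟩ fun t ht => ht.1.2⟩
    refine ⟨sSup P, hτ, ?_, ?_⟩
    · obtain ⟨t, ⟨ht, s, hs, hts⟩, hlt⟩ := exists_lt_of_lt_csSup ⟨0, h0⟩ (sub_lt_self (sSup P) hη)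
      exact ⟨t, ht, s, hs, hlt, hts⟩
    · by_cases hle : sSup P + η ≤ R
      · have ht3 : sSup P + η ∈ Icc 0 R := ⟨by linarith [hτ.1], hle⟩
        refine ⟨c (e * (sSup P + η)), hcc _, hcF _, ?_, Or.inr ⟨_, ht3, rfl⟩, ?_⟩
        · have h5 := hqF _ (habs e he _ ht3)
          refine le_trans (ENNReal.ofReal_le_ofReal ?_)
            (ofReal_sub_dist_le_hausdorffMeasure_component hγ h5.1 h5.2 hout)
          have h6 := hqx _ (habs e he _ ht3)
          rw [abs_mul, he, one_mul, abs_of_nonneg ht3.1] at h6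
          linarith
        · intro s hs
          refine hcd _ _ fun h => ?_
          have : sSup P + η ∈ P := ⟨ht3, s, hs, h⟩
          linarith [le_csSup hb this]
      -- Here `ρ - τ - 2 * η` is negative, so no outer piece is needed.
      · refine ⟨∅, isClosed_empty, empty_subset _, ?_, Or.inl rfl, fun _ _ => empty_disjoint _⟩
        rw [ENNReal.ofReal_of_nonpos (by linarith)]
        exact zero_le
  obtain ⟨τ, hτ, ⟨t₁, ht₁, s₁, hs₁, hτt, h₁⟩, A, hAc, hAF, hAm, hAeq, hAd⟩ := side 1 (by simp)
  obtain ⟨σ, hσ, ⟨t₂, ht₂, s₂, hs₂, hσt, h₂⟩, B, hBc, hBF, hBm, -, hBd⟩ := side (-1) (by simp)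
  simp only [neg_neg] at h₂ hBd
  have a₁ := habs 1 (by simp) t₁ ht₁
  have b₁ := habs (-1) (by simp) s₁ hs₁
  have a₂ := habs (-1) (by simp) t₂ ht₂
  have b₂ := habs 1 (by simp) s₂ hs₂
  have hAB : Disjoint A B := by
    rcases hAeq with rfl | ⟨t, ht, rfl⟩
    · exact empty_disjoint _
    · exact (hBd t ht).symm
  have hM : ENNReal.ofReal (τ + σ - 6 * η) ≤ μH[1] (c (1 * t₁) ∪ c (-1 * t₂)) := by
    by_cases heq : c (1 * t₁) = c (-1 * t₂)
    · rw [← heq, union_self]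
      refine le_trans (ENNReal.ofReal_le_ofReal ?_) (hcm _ _ a₁ a₂ heq)
      have := le_abs_self (1 * t₁ - -1 * t₂)
      linarith
    · rw [measure_union (hcd _ _ heq) (hcc _).measurableSet]
      refine le_trans ?_ (add_le_add (hcm _ _ a₁ b₁ h₁) (hcm _ _ a₂ b₂ h₂))
      refine le_trans (ENNReal.ofReal_le_ofReal ?_) ENNReal.ofReal_add_le
      have h7 := le_abs_self (1 * t₁ - -1 * s₁)
      have h8 := neg_abs_le (-1 * t₂ - 1 * s₂)
      linarith [hs₁.1, hs₂.1]
  have hMc : IsClosed (c (1 * t₁) ∪ c (-1 * t₂)) := (hcc _).union (hcc _)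
  have hAM : Disjoint A (c (1 * t₁) ∪ c (-1 * t₂)) :=
    disjoint_union_right.2 ⟨h₁ ▸ hAd s₁ hs₁, hAd t₂ ht₂⟩
  have hBM : Disjoint B (c (1 * t₁) ∪ c (-1 * t₂)) :=
    disjoint_union_right.2 ⟨hBd t₁ ht₁, h₂ ▸ hBd s₂ hs₂⟩
  calc ENNReal.ofReal (2 * ρ - 10 * η)
      ≤ ENNReal.ofReal ((ρ - τ - 2 * η) + (ρ - σ - 2 * η) + (τ + σ - 6 * η)) :=
        ENNReal.ofReal_le_ofReal (by linarith)
    _ ≤ μH[1] A + μH[1] B + μH[1] (c (1 * t₁) ∪ c (-1 * t₂)) :=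
        ENNReal.ofReal_add_le.trans (add_le_add (ENNReal.ofReal_add_le.trans
          (add_le_add hAm hBm)) hM)
    _ = μH[1] (A ∪ B ∪ (c (1 * t₁) ∪ c (-1 * t₂))) := by
        rw [measure_union (disjoint_union_left.2 ⟨hAM, hBM⟩) hMc.measurableSet,
          measure_union hAB hBc.measurableSet]
    _ ≤ μH[1] F := measure_mono
        (union_subset (union_subset hAF hBF) (union_subset (hcF _) (hcF _)))

/-! ### Almost every point of a curve is regular -/

theorem hausdorffMeasure_image_eq_zero_of_lipschitzOnWith {V : Type*} [MetricSpace V]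
    [MeasurableSpace V] [BorelSpace V] {γ : ℝ → V} {K : ℝ≥0} {s N : Set ℝ}
    (hγ : LipschitzOnWith K γ s) (hN : N ⊆ s) (h0 : volume N = 0) : μH[1] (γ '' N) = 0 := by
  have := (hγ.mono hN).hausdorffMeasure_image_le (d := 1) zero_le_one
  rw [hausdorffMeasure_real, h0, mul_zero] at this
  exact le_antisymm this zero_le

section Sard

variable {V : Type*} [NormedAddCommGroup V] [NormedSpace ℝ V] [MeasurableSpace V] [BorelSpace V]

/-- A Sard argument. The sets `W m`, where `γ` moves at rate at most `ε` on scale `1 / (m + 1)`,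
exhaust the critical set. Cut at that scale, `W m` has at most `m + 2` pieces, each with image of
length at most `ε / (m + 1)`. -/
theorem hausdorffMeasure_image_hasDerivAt_zero (γ : ℝ → V) :
    μH[1] (γ '' {t | t ∈ Icc (0 : ℝ) 1 ∧ HasDerivAt γ 0 t}) = 0 := by
  set Z := {t | t ∈ Icc (0 : ℝ) 1 ∧ HasDerivAt γ 0 t} with hZ
  suffices h : ∀ ε : ℝ≥0, 0 < ε → μH[1] (γ '' Z) ≤ 2 * ε by
    refine le_antisymm (ENNReal.le_of_forall_pos_le_add fun ε hε _ => ?_) zero_le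
    refine (h (ε / 2) (by positivity)).trans (le_of_eq ?_)
    rw [zero_add, ← ENNReal.coe_ofNat, ← ENNReal.coe_mul, mul_div_cancel₀ _ two_ne_zero]
  intro ε hε
  set W : ℕ → Set ℝ := fun m => {t | t ∈ Z ∧ ∀ s, |s - t| ≤ 1 / ((m : ℝ) + 1) →
    dist (γ s) (γ t) ≤ ε * |s - t|} with hW
  have hmono : Monotone W := fun a b hab t ht =>
    ⟨ht.1, fun s hs => ht.2 s (hs.trans (one_div_le_one_div_of_le (by positivity) (by gcongr)))⟩
  have hU : γ '' Z = ⋃ m, γ '' W m := by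
    rw [← image_iUnion]
    congr 1
    refine Subset.antisymm (fun t ht => ?_) (iUnion_subset fun m t ht => ht.1)
    have h1 := (hasDerivAt_iff_isLittleO.1 ht.2).bound (NNReal.coe_pos.2 hε)
    obtain ⟨δ, hδ, h2⟩ := Metric.eventually_nhds_iff.1 h1
    obtain ⟨m, hm⟩ := exists_nat_one_div_lt hδ
    refine mem_iUnion.2 ⟨m, ht, fun s hs => ?_⟩
    have h3 := h2 (y := s) (by rw [Real.dist_eq]; exact hs.trans_lt hm)
    simpa [dist_eq_norm] using h3
  have hmono' : Monotone fun m => γ '' W m := fun a b hab => image_mono (hmono hab)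
  rw [hU, hmono'.measure_iUnion]
  refine iSup_le fun m => ?_
  set I : ℕ → Set ℝ := fun k => Icc ((k : ℝ) / (m + 1)) ((k + 1 : ℝ) / (m + 1)) with hI
  have hm : (0 : ℝ) < m + 1 := by positivity
  have hcover : γ '' W m ⊆ ⋃ k ∈ Finset.range (m + 2), γ '' (W m ∩ I k) := by
    rintro _ ⟨t, ht, rfl⟩
    have ht0 := ht.1.1
    have h0 : 0 ≤ t * (m + 1) := mul_nonneg ht0.1 hm.le
    refine mem_iUnion₂.2 ⟨⌊t * (m + 1)⌋₊, ?_, t, ⟨ht, ?_, ?_⟩, rfl⟩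
    · rw [Finset.mem_range]
      have : ⌊t * ((m : ℝ) + 1)⌋₊ ≤ m + 1 := by
        refine Nat.floor_le_of_le ?_
        push_cast
        nlinarith [ht0.2]
      omega
    · rw [div_le_iff₀ hm]; exact Nat.floor_le h0
    · rw [le_div_iff₀ hm]; exact (Nat.lt_floor_add_one _).le
  have hpiece : ∀ k, μH[1] (γ '' (W m ∩ I k)) ≤ ε * ENNReal.ofReal (1 / (m + 1)) := fun k => by
    have hL : LipschitzOnWith ε γ (W m ∩ I k) := LipschitzOnWith.of_dist_le_mul
      fun s hs t ht => ht.1.2 s (by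
        have h4 : (k + 1 : ℝ) / (m + 1) - k / (m + 1) = 1 / (m + 1) := by ring
        rw [abs_le]
        constructor <;> linarith [hs.2.1, hs.2.2, ht.2.1, ht.2.2])
    refine (hL.hausdorffMeasure_image_le zero_le_one).trans ?_
    rw [ENNReal.rpow_one, hausdorffMeasure_real]
    gcongr
    refine (measure_mono inter_subset_right).trans ?_
    rw [hI, Real.volume_Icc]
    exact ENNReal.ofReal_le_ofReal (le_of_eq (by ring))
  refine (measure_mono hcover).trans ((measure_biUnion_finset_le _ _).trans ?_)
  refine (Finset.sum_le_sum fun k _ => hpiece k).trans ?_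
  rw [Finset.sum_const, Finset.card_range, nsmul_eq_mul, mul_left_comm, mul_comm]
  gcongr
  rw [← ENNReal.ofReal_natCast, ← ENNReal.ofReal_mul (by positivity), ← ENNReal.ofReal_ofNat]
  refine ENNReal.ofReal_le_ofReal ?_
  rw [mul_one_div, div_le_iff₀ hm]
  push_cast
  linarith [(Nat.cast_nonneg m : (0 : ℝ) ≤ m)]

/-- Rademacher handles the points of non-differentiability, the Sard argument those of zero
derivative. -/
theorem hausdorffMeasure_image_irregular_eq_zero [FiniteDimensional ℝ V] {γ : ℝ → V} {K : ℝ≥0}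
    (hγ : LipschitzOnWith K γ (Icc 0 1)) :
    μH[1] (γ '' (Icc 0 1 \ {t | t ∈ Ioo (0 : ℝ) 1 ∧ ∃ v, v ≠ 0 ∧ HasDerivAt γ v t})) = 0 := by
  set N : Set ℝ := {t | t ∈ Icc (0 : ℝ) 1 ∧ (t ∈ Ioo (0 : ℝ) 1 → ¬ DifferentiableAt ℝ γ t)} with hN
  have hN0 : volume N = 0 := by
    have h1 := hγ.ae_differentiableWithinAt_of_mem_real
    have h2 : volume ({0, 1} : Set ℝ) = 0 := (Set.toFinite _).measure_zero _
    refine measure_mono_null (t := {0, 1} ∪ {t | ¬ (t ∈ Icc (0 : ℝ) 1 →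
      DifferentiableWithinAt ℝ γ (Icc 0 1) t)}) ?_ (measure_union_null h2 h1)
    rintro t ⟨ht, htd⟩
    by_cases ht' : t ∈ Ioo (0 : ℝ) 1
    · right
      exact fun h => htd ht' ((h ht).differentiableAt (Icc_mem_nhds ht'.1 ht'.2))
    · left
      rcases eq_endpoints_or_mem_Ioo_of_mem_Icc ht with h | h | h
      · exact Or.inl h
      · exact Or.inr h
      · exact absurd h ht'
  refine measure_mono_null (t := γ '' N ∪ γ '' {t | t ∈ Icc (0 : ℝ) 1 ∧ HasDerivAt γ 0 t}) ?_
    (measure_union_null (hausdorffMeasure_image_eq_zero_of_lipschitzOnWith hγ (fun t ht => ht.1) hN0)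
      (hausdorffMeasure_image_hasDerivAt_zero γ))
  rw [← image_union]
  refine image_mono ?_
  rintro t ⟨ht, htG⟩
  by_cases htN : t ∈ N
  · exact Or.inl htN
  · right
    have : t ∈ Ioo (0 : ℝ) 1 ∧ DifferentiableAt ℝ γ t := by
      by_contra hc
      exact htN ⟨ht, fun h1 h2 => hc ⟨h1, h2⟩⟩
    refine ⟨ht, ?_⟩
    by_cases hv : deriv γ t = 0
    · exact hv ▸ this.2.hasDerivAt
    · exact absurd ⟨this.1, _, hv, this.2.hasDerivAt⟩ htG

end Sard

/-! ### Gołąb's semicontinuity theorem -/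

theorem ediam_closedBall_le_ofReal {X : Type*} [PseudoMetricSpace X] (x : X) (r : ℝ) :
    ediam (closedBall x r) ≤ ENNReal.ofReal (2 * r) :=
  ediam_le_of_forall_dist_le fun y hy z hz => by
    linarith [dist_triangle_right y z x, mem_closedBall.1 hy, mem_closedBall.1 hz]

theorem exists_dist_lt_of_hausdorffEDist_lt_ofReal {X : Type*} [PseudoMetricSpace X] {A B : Set X}
    {x : X} (hx : x ∈ A) {r : ℝ} (h : hausdorffEDist A B < ENNReal.ofReal r) :
    ∃ y ∈ B, dist x y < r := by
  obtain ⟨y, hy, hxy⟩ := exists_edist_lt_of_hausdorffEDist_lt hx h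
  refine ⟨y, hy, ?_⟩
  rw [edist_dist] at hxy
  exact (ENNReal.ofReal_lt_ofReal_iff_of_nonneg dist_nonneg).1 hxy

theorem exists_radius_eventually_le_hausdorffMeasure_inter_closedBall {V ι : Type*}
    [NormedAddCommGroup V] [NormedSpace ℝ V] [MeasurableSpace V] [BorelSpace V] {l : Filter ι}
    {γ : ℝ → V} {γs : ι → ℝ → V} (hγs : ∀ j, ContinuousOn (γs j) (Icc 0 1))
    (hlim : Tendsto (fun j => hausdorffEDist (γs j '' Icc 0 1) (γ '' Icc 0 1)) l (𝓝 0))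
    {t₀ : ℝ} (ht₀ : t₀ ∈ Ioo (0 : ℝ) 1) {v : V} (hv : v ≠ 0) (hd : HasDerivAt γ v t₀)
    {ε : ℝ} (hε : 0 < ε) (hε1 : ε < 1) {δ : ℝ} (hδ : 0 < δ) :
    ∃ ρ ∈ Ioo 0 δ, ∀ᶠ j in l, ENNReal.ofReal ((1 - ε) * (2 * ρ)) ≤
      μH[1] (γs j '' Icc 0 1 ∩ closedBall (γ t₀) ρ) := by
  have hv' : 0 < ‖v‖ := norm_pos_iff.2 hv
  -- The tangent error is then `ε * ρ / 20`; with a Hausdorff error `ε * ρ / 10` the total is below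
  -- `η = ε * ρ / 5`, and `10 * η` is exactly the allowed loss `2 * ε * ρ`.
  set c := ε * ‖v‖ / 20 with hc
  have hc0 : 0 < c := by positivity
  have h1 := ((hasDerivAt_iff_isLittleO.1 hd).bound hc0).and (Ioo_mem_nhds ht₀.1 ht₀.2)
  obtain ⟨h₀, hh₀, h2⟩ := Metric.eventually_nhds_iff.1 h1
  have key : ∀ h, |h| < h₀ → ‖γ (t₀ + h) - γ t₀ - h • v‖ ≤ c * |h| ∧ t₀ + h ∈ Icc (0 : ℝ) 1 :=
    fun h hh => by
      have h3 := h2 (y := t₀ + h) (by simpa [Real.dist_eq] using hh)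
      exact ⟨by simpa using h3.1, Ioo_subset_Icc_self h3.2⟩
  set d := dist (γ (t₀ + h₀ / 2)) (γ t₀) with hddef
  have hd0 : 0 < d := by
    have h4 := (key (h₀ / 2) (by rw [abs_of_pos (by positivity)]; linarith)).1
    rw [hddef, dist_pos]
    intro heq
    rw [heq, sub_self, zero_sub, norm_neg, norm_smul, Real.norm_eq_abs,
      abs_of_pos (by positivity : 0 < h₀ / 2)] at h4
    have h5 : c < ‖v‖ := by nlinarith
    nlinarith
  -- The bound `‖v‖ * h₀` keeps the diameter in the range of the tangent estimate; `d / 2` forces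
  -- nearby curves to leave the ball.
  obtain ⟨ρ, hρ0, hρ⟩ := exists_between (lt_min hδ (lt_min (by positivity : 0 < ‖v‖ * h₀)
    (by positivity : 0 < d / 2)))
  rw [lt_min_iff, lt_min_iff] at hρ
  refine ⟨ρ, ⟨hρ0, hρ.1⟩, ?_⟩
  have hη : 0 < ε * ρ / 10 := by positivity
  have hηρ : ε * ρ / 10 < ρ / 10 := by nlinarith
  filter_upwards [hlim.eventually (gt_mem_nhds (ENNReal.ofReal_pos.2 hη))] with j hj
  rw [hausdorffEDist_comm] at hj
  set u := ‖v‖⁻¹ • v with hu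
  have hu1 : ‖u‖ = 1 := by rw [hu, norm_smul, norm_inv, norm_norm, inv_mul_cancel₀ hv'.ne']
  refine le_trans (ENNReal.ofReal_le_ofReal ?_)
    (ofReal_two_mul_sub_le_hausdorffMeasure_inter_closedBall (hγs j) (x := γ t₀) hu1
      (ρ := ρ) (η := ε * ρ / 5) (by positivity) (by nlinarith) ?_ ?_)
  · linarith
  · intro s hs
    have hs' : |s| ≤ ρ := abs_le.2 hs
    have hsv : |s / ‖v‖| ≤ ρ / ‖v‖ := by rw [abs_div, abs_norm]; gcongr
    obtain ⟨k1, k2⟩ := key (s / ‖v‖) (hsv.trans_lt (by rw [div_lt_iff₀ hv']; linarith [hρ.2.1]))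
    obtain ⟨y, hy, hyd⟩ := exists_dist_lt_of_hausdorffEDist_lt_ofReal (mem_image_of_mem γ k2) hj
    refine ⟨y, hy, ?_⟩
    have h5 : dist (γ (t₀ + s / ‖v‖)) (γ t₀ + s • u) ≤ ε * ρ / 20 := by
      rw [dist_eq_norm, ← sub_sub, hu, smul_smul, ← div_eq_mul_inv]
      refine k1.trans ?_
      calc c * |s / ‖v‖| ≤ c * (ρ / ‖v‖) := by gcongr
        _ = ε * ρ / 20 := by rw [hc]; field_simp
    have h6 := dist_triangle y (γ (t₀ + s / ‖v‖)) (γ t₀ + s • u)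
    rw [dist_comm] at hyd
    linarith
  · have k2 := (key (h₀ / 2) (by rw [abs_of_pos (by positivity)]; linarith)).2
    obtain ⟨y, hy, hyd⟩ := exists_dist_lt_of_hausdorffEDist_lt_ofReal (mem_image_of_mem γ k2) hj
    refine ⟨y, hy, ?_⟩
    have h6 := dist_triangle (γ (t₀ + h₀ / 2)) y (γ t₀)
    linarith [hρ.2.2]

/-- Besicovitch covers almost all of the limit by disjoint small balls in which the approximating
curves eventually have length at least `1 - ε` times the diameter. Summing bounds the diameter sums
by the liminf of lengths; as the mesh tends to zero, these sums control the Hausdorff measure. -/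
theorem hausdorffMeasure_le_liminf_of_tendsto_hausdorffEDist {V : Type*} [NormedAddCommGroup V]
    [NormedSpace ℝ V] [FiniteDimensional ℝ V] [MeasurableSpace V] [BorelSpace V] {γ : ℝ → V}
    {K : ℝ≥0} (hγ : LipschitzOnWith K γ (Icc 0 1)) {γs : ℕ → ℝ → V}
    (hγs : ∀ j, ContinuousOn (γs j) (Icc 0 1))
    (hlim : Tendsto (fun j => hausdorffEDist (γs j '' Icc 0 1) (γ '' Icc 0 1)) atTop (𝓝 0)) :
    μH[1] (γ '' Icc 0 1) ≤ liminf (fun j => μH[1] (γs j '' Icc 0 1)) atTop := by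
  set Γ := γ '' Icc 0 1 with hΓ
  set G := {t | t ∈ Ioo (0 : ℝ) 1 ∧ ∃ v, v ≠ 0 ∧ HasDerivAt γ v t} with hG
  set L := liminf (fun j => μH[1] (γs j '' Icc 0 1)) atTop with hL
  have hfin : μH[1] Γ < ∞ := by
    refine (hγ.hausdorffMeasure_image_le zero_le_one).trans_lt ?_
    rw [hausdorffMeasure_real, Real.volume_Icc]
    exact ENNReal.mul_lt_top (by simp) (by simp)
  have : IsFiniteMeasure ((μH[1] : Measure V).restrict Γ) := ⟨by simpa using hfin⟩
  have hGΓ : γ '' G ⊆ Γ := image_mono fun t ht => Ioo_subset_Icc_self ht.1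
  have main : ∀ ε : ℝ, 0 < ε → ε < 1 → ENNReal.ofReal (1 - ε) * μH[1] Γ ≤ L := by
    intro ε hε hε1
    set f : V → Set ℝ := fun x => {ρ | ∀ᶠ j in atTop, ENNReal.ofReal ((1 - ε) * (2 * ρ)) ≤
      μH[1] (γs j '' Icc 0 1 ∩ closedBall x ρ)} with hf
    have hfne : ∀ x ∈ γ '' G, ∀ δ > 0, (f x ∩ Ioo 0 δ).Nonempty := by
      rintro _ ⟨t, ⟨ht, v, hv, hd⟩, rfl⟩ δ hδ
      obtain ⟨ρ, hρ, h⟩ := exists_radius_eventually_le_hausdorffMeasure_inter_closedBall hγs hlim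
        ht hv hd hε hε1 hδ
      exact ⟨ρ, h, hρ⟩
    have hcov := fun k : ℕ => Besicovitch.exists_disjoint_closedBall_covering_ae
      ((μH[1] : Measure V).restrict Γ) f (γ '' G) hfne (fun _ => 1 / ((k : ℝ) + 1))
      (fun _ _ => by positivity)
    choose T r hTc hTG hr hnull hdisj using hcov
    -- The points covered at every scale `k`; only a null set is lost.
    set S := γ '' G \ ⋃ k, (γ '' G \ ⋃ x ∈ T k, closedBall x (r k x)) with hS
    have hΓS : μH[1] Γ ≤ μH[1] S := by
      have h1 : Γ ⊆ S ∪ (γ '' (Icc 0 1 \ G) ∪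
          ⋃ k, (γ '' G \ ⋃ x ∈ T k, closedBall x (r k x))) := by
        rintro _ ⟨t, ht, rfl⟩
        by_cases htG : t ∈ G
        · by_cases h : γ t ∈ ⋃ k, (γ '' G \ ⋃ x ∈ T k, closedBall x (r k x))
          · exact Or.inr (Or.inr h)
          · exact Or.inl ⟨⟨t, htG, rfl⟩, h⟩
        · exact Or.inr (Or.inl ⟨t, ⟨ht, htG⟩, rfl⟩)
      refine (measure_mono h1).trans ((measure_union_le _ _).trans (le_of_eq ?_))
      rw [measure_union_null (hausdorffMeasure_image_irregular_eq_zero hγ)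
        (measure_iUnion_null fun k => ?_), add_zero]
      have h2 := hnull k
      rw [Measure.restrict_eq_self _ (sdiff_subset.trans hGΓ)] at h2
      exact h2
    have : ∀ k, Countable (T k) := fun k => (hTc k).to_subtype
    have hbound := Measure.hausdorffMeasure_le_liminf_tsum (ι := fun k => T k) 1 S (l := atTop)
      (fun k : ℕ => ENNReal.ofReal (2 * (1 / ((k : ℝ) + 1))))
      (by
        have := (tendsto_one_div_add_atTop_nhds_zero_nat (𝕜 := ℝ)).const_mul 2
        simpa using ENNReal.tendsto_ofReal this)
      (fun k x => closedBall (x : V) (r k x))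
      (Eventually.of_forall fun k x => by
        refine (ediam_closedBall_le_ofReal _ _).trans ?_
        exact ENNReal.ofReal_le_ofReal (by linarith [(hr k x x.2).2.2]))
      (Eventually.of_forall fun k y hy => by
        by_contra hc
        refine hy.2 (mem_iUnion.2 ⟨k, hy.1, fun h => hc ?_⟩)
        obtain ⟨x, hx, hyx⟩ := mem_iUnion₂.1 h
        exact mem_iUnion.2 ⟨⟨x, hx⟩, hyx⟩)
    have hsum : ∀ k, ENNReal.ofReal (1 - ε) *
        ∑' x : T k, ediam (closedBall (x : V) (r k x)) ^ (1 : ℝ) ≤ L := by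
      intro k
      rw [← ENNReal.tsum_mul_left]
      -- The threshold in `j` depends on the ball, so only finitely many balls can be treated at
      -- once.
      refine ENNReal.summable.tsum_le_of_sum_le fun s => ?_
      refine le_liminf_of_le (by isBoundedDefault) ?_
      have hev : ∀ᶠ j in atTop, ∀ x ∈ s, ENNReal.ofReal ((1 - ε) * (2 * r k x)) ≤
          μH[1] (γs j '' Icc 0 1 ∩ closedBall (x : V) (r k x)) :=
        (Finset.eventually_all s).2 fun x _ => (hr k x x.2).1
      filter_upwards [hev] with j hj
      calc ∑ x ∈ s, ENNReal.ofReal (1 - ε) * ediam (closedBall (x : V) (r k x)) ^ (1 : ℝ)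
          ≤ ∑ x ∈ s, μH[1] (γs j '' Icc 0 1 ∩ closedBall (x : V) (r k x)) := by
            refine Finset.sum_le_sum fun x hx => le_trans ?_ (hj x hx)
            rw [ENNReal.ofReal_mul (by linarith), ENNReal.rpow_one]
            gcongr
            exact ediam_closedBall_le_ofReal _ _
        _ = μH[1] (⋃ x ∈ s, γs j '' Icc 0 1 ∩ closedBall (x : V) (r k x)) := by
            refine (measure_biUnion_finset (fun x _ y _ hxy => ?_) fun x _ => ?_).symm
            · exact (hdisj k x.2 y.2 (fun h => hxy (Subtype.ext h))).mono inter_subset_right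
                inter_subset_right
            · exact ((isCompact_Icc.image_of_continuousOn (hγs j)).isClosed.inter
                isClosed_closedBall).measurableSet
        _ ≤ μH[1] (γs j '' Icc 0 1) := measure_mono (iUnion₂_subset fun _ _ => inter_subset_left)
    have hpos : ENNReal.ofReal (1 - ε) ≠ 0 := by
      rw [Ne, ENNReal.ofReal_eq_zero, not_le]; linarith
    rw [mul_comm, ← ENNReal.le_div_iff_mul_le (Or.inl hpos) (Or.inl ENNReal.ofReal_ne_top)]
    refine (hΓS.trans hbound).trans ?_
    refine (liminf_le_liminf (v := fun _ => L / ENNReal.ofReal (1 - ε))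
      (Eventually.of_forall fun k => ?_)).trans (liminf_const _).le
    rw [ENNReal.le_div_iff_mul_le (Or.inl hpos) (Or.inl ENNReal.ofReal_ne_top), mul_comm]
    exact hsum k
  have hlim1 : Tendsto (fun ε : ℝ => ENNReal.ofReal (1 - ε) * μH[1] Γ) (𝓝[>] 0) (𝓝 (μH[1] Γ)) := by
    have h1 : Tendsto (fun ε : ℝ => ENNReal.ofReal (1 - ε)) (𝓝[>] 0) (𝓝 1) := by
      have : Tendsto (fun ε : ℝ => ENNReal.ofReal (1 - ε)) (𝓝 0) (𝓝 (ENNReal.ofReal (1 - 0))) :=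
        (ENNReal.continuous_ofReal.comp (continuous_const.sub continuous_id)).tendsto 0
      rw [sub_zero, ENNReal.ofReal_one] at this
      exact this.mono_left nhdsWithin_le_nhds
    simpa using ENNReal.Tendsto.mul_const h1 (Or.inr hfin.ne)
  refine le_of_tendsto hlim1 ?_
  filter_upwards [Ioo_mem_nhdsGT (zero_lt_one' ℝ)] with ε hε
  exact main ε hε.1 hε.2

/-! ### Hausdorff limits of curves are curves -/

/-- The last hypothesis is connectedness of the graph on `S`. Each new vertex is inserted by a
detour from a visited neighbor and back, which costs two steps. -/
theorem exists_walk_visiting_all {X : Type*} {R : X → X → Prop} (hrefl : ∀ x, R x x)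
    (hsymm : ∀ x y, R x y → R y x) (S : Finset X) (hS : S.Nonempty)
    (h : ∀ A ⊆ S, A.Nonempty → A ≠ S → ∃ u ∈ A, ∃ w ∈ S, w ∉ A ∧ R u w) :
    ∃ f : ℕ → X, (∀ i, R (f i) (f (i + 1))) ∧ (∀ i, f i ∈ S) ∧
      ∀ x ∈ S, ∃ i ≤ 2 * S.card, f i = x := by
  classical
  obtain ⟨a₀, ha₀⟩ := hS
  have key : ∀ k, k + 1 ≤ S.card → ∃ f : ℕ → X, (∀ i, R (f i) (f (i + 1))) ∧ (∀ i, f i ∈ S) ∧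
      k + 1 ≤ ((Finset.range (2 * k + 1)).image f).card := by
    intro k
    induction k with
    | zero => exact fun _ => ⟨fun _ => a₀, fun _ => hrefl _, fun _ => ha₀, by simp⟩
    | succ k ih =>
      intro hk
      obtain ⟨f, hf, hfS, hcard⟩ := ih (by omega)
      set A := (Finset.range (2 * k + 1)).image f with hA
      by_cases hAS : A = S
      · refine ⟨f, hf, hfS, hk.trans ?_⟩
        rw [← hAS]
        exact Finset.card_le_card (Finset.image_subset_image
          (Finset.range_subset_range.2 (by omega)))
      · obtain ⟨u, hu, w, hwS, hwA, huw⟩ := h A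
          (Finset.image_subset_iff.2 fun i _ => hfS i) (Finset.card_pos.1 (by omega)) hAS
        obtain ⟨a, ha, rfl⟩ := Finset.mem_image.1 hu
        rw [Finset.mem_range] at ha
        -- Visit `w` right after time `a`, return to `f a` at time `a + 2`, then resume.
        set f' : ℕ → X := fun i => if i ≤ a then f i else if i = a + 1 then w else f (i - 2)
          with hf'
        have e₁ : ∀ i ≤ a, f' i = f i := fun i hi => if_pos hi
        have e₂ : f' (a + 1) = w := by simp [hf']
        have e₃ : ∀ i, a ≤ i → f' (i + 2) = f i := fun i hi => by
          simp [hf', show ¬ i + 2 ≤ a by omega, show i + 2 ≠ a + 1 by omega]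
        refine ⟨f', fun i => ?_, fun i => ?_, ?_⟩
        · rcases lt_trichotomy i a with hi | rfl | hi
          · rw [e₁ i hi.le, e₁ (i + 1) hi]; exact hf i
          · rw [e₁ i le_rfl, e₂]; exact huw
          · obtain ⟨j, rfl⟩ := Nat.exists_eq_add_of_lt hi
            rcases Nat.eq_zero_or_pos j with rfl | hj
            · rw [add_zero, e₂, e₃ a le_rfl]; exact hsymm _ _ huw
            · obtain ⟨j, rfl⟩ := Nat.exists_eq_add_of_lt hj
              rw [show a + (0 + j + 1) + 1 = a + j + 2 by ring,
                show a + j + 2 + 1 = a + j + 1 + 2 by ring, e₃ _ (by omega), e₃ _ (by omega)]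
              exact hf _
        · simp only [hf']
          split_ifs
          exacts [hfS _, hwS, hfS _]
        · have hsub : insert w A ⊆ (Finset.range (2 * (k + 1) + 1)).image f' := by
            refine Finset.insert_subset (Finset.mem_image.2 ⟨a + 1, by simp; omega, e₂⟩) ?_
            refine Finset.image_subset_iff.2 fun i hi => ?_
            rw [Finset.mem_range] at hi
            by_cases hia : i ≤ a
            · exact Finset.mem_image.2 ⟨i, by simp; omega, e₁ i hia⟩
            · exact Finset.mem_image.2 ⟨i + 2, by simp; omega, e₃ i (by omega)⟩
          have := Finset.card_le_card hsub
          rw [Finset.card_insert_of_notMem hwA] at this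
          omega
  have hpos : 0 < S.card := Finset.card_pos.2 ⟨a₀, ha₀⟩
  obtain ⟨f, hf, hfS, hcard⟩ := key (S.card - 1) (by omega)
  refine ⟨f, hf, hfS, fun x hx => ?_⟩
  have := Finset.eq_of_subset_of_card_le (Finset.image_subset_iff.2 fun i _ => hfS i :
    (Finset.range (2 * (S.card - 1) + 1)).image f ⊆ S) (by omega)
  rw [← this] at hx
  obtain ⟨i, hi, rfl⟩ := Finset.mem_image.1 hx
  rw [Finset.mem_range] at hi
  exact ⟨i, by omega, rfl⟩

theorem dist_le_mul_abs_sub_of_dist_succ_le {X : Type*} [PseudoMetricSpace X] {f : ℕ → X} {c : ℝ}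
    (hf : ∀ i, dist (f i) (f (i + 1)) ≤ c) (i j : ℕ) : dist (f i) (f j) ≤ c * |(i : ℝ) - j| := by
  wlog h : i ≤ j generalizing i j
  · rw [dist_comm, abs_sub_comm]; exact this j i (le_of_not_ge h)
  have := dist_le_Ico_sum_of_dist_le (f := f) h (d := fun _ => c) fun _ _ => hf _
  rw [Finset.sum_const, Nat.card_Ico, nsmul_eq_mul, Nat.cast_sub h] at this
  rw [abs_sub_comm, abs_of_nonneg (by simpa using h), mul_comm]
  exact this

theorem abs_floor_sub_floor_le {a b : ℝ} (ha : 0 ≤ a) (hb : 0 ≤ b) :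
    |(⌊a⌋₊ : ℝ) - ⌊b⌋₊| ≤ |a - b| + 1 := by
  have h1 := Nat.floor_le ha
  have h2 := Nat.floor_le hb
  have h3 := Nat.lt_floor_add_one a
  have h4 := Nat.lt_floor_add_one b
  have h5 := le_abs_self (a - b)
  have h6 := neg_abs_le (a - b)
  rw [abs_le]
  constructor <;> linarith

theorem IsCompact.exists_tendsto_ultrafilter {Y ι : Type*} [TopologicalSpace Y] {K : Set Y}
    (hK : IsCompact K) (U : Ultrafilter ι) (a : ι → Y) (ha : ∀ k, a k ∈ K) :
    ∃ y ∈ K, Tendsto a U (𝓝 y) :=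
  isCompact_iff_ultrafilter_le_nhds'.1 hK (U.map a)
    (Filter.Eventually.of_forall (f := (U : Filter ι)) ha)

section Net

variable {X : Type*} [MetricSpace X] {γ : ℝ → X} {Γ : Set X} {ε : ℝ}

/-- The points of the curve near `S` are centers of disjoint balls of radius `ε / 4`. By `hdiam` the
curve leaves each ball, hence has length at least `ε / 4` in it. -/
theorem card_mul_le_of_separated [MeasurableSpace X] [BorelSpace X]
    (hγ : ContinuousOn γ (Icc 0 1)) (hε : 0 < ε)
    (hclose : hausdorffEDist Γ (γ '' Icc 0 1) < ENNReal.ofReal (ε / 8))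
    {ℓ : ℝ} (hℓ : 0 ≤ ℓ) (hμ : μH[1] (γ '' Icc 0 1) ≤ ENNReal.ofReal ℓ)
    (hdiam : ∃ x ∈ Γ, ∃ y ∈ Γ, ε ≤ dist x y) {S : Finset X} (hS : (S : Set X) ⊆ Γ)
    (hsep : (S : Set X).Pairwise fun x y => ε ≤ dist x y) : S.card * ε ≤ 4 * ℓ := by
  have hp := fun (x : X) (hx : x ∈ Γ) => exists_dist_lt_of_hausdorffEDist_lt_ofReal hx hclose
  choose! p hpK hpx using hp
  have hpp : ∀ x ∈ Γ, ∀ y ∈ Γ, ε ≤ dist x y → 3 * ε / 4 ≤ dist (p x) (p y) := fun x hx y hy h => by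
    have h1 := dist_triangle4 x (p x) (p y) y
    rw [dist_comm (p y) y] at h1
    linarith [hpx x hx, hpx y hy]
  obtain ⟨x₀, hx₀, y₀, hy₀, hxy⟩ := hdiam
  have hball : ∀ z ∈ γ '' Icc 0 1, ENNReal.ofReal (ε / 4) ≤
      μH[1] (γ '' Icc 0 1 ∩ closedBall z (ε / 4)) := fun z hz => by
    have hout : ∃ w ∈ γ '' Icc 0 1, ε / 4 ≤ dist w z := by
      by_contra! hc
      have h1 := hpp x₀ hx₀ y₀ hy₀ hxy
      have h2 := dist_triangle_right (p x₀) (p y₀) z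
      linarith [hc _ (hpK x₀ hx₀), hc _ (hpK y₀ hy₀)]
    have h3 := ofReal_sub_dist_le_hausdorffMeasure_component hγ hz (ρ := ε / 4)
      (by rw [dist_self]; positivity) hout
    rw [dist_self, sub_zero] at h3
    exact h3.trans (measure_mono (connectedComponentIn_subset _ _))
  have hsum : (S.card : ℝ≥0∞) * ENNReal.ofReal (ε / 4) ≤ ENNReal.ofReal ℓ := by
    calc (S.card : ℝ≥0∞) * ENNReal.ofReal (ε / 4) = ∑ x ∈ S, ENNReal.ofReal (ε / 4) := by
          rw [Finset.sum_const, nsmul_eq_mul]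
      _ ≤ ∑ x ∈ S, μH[1] (γ '' Icc 0 1 ∩ closedBall (p x) (ε / 4)) :=
          Finset.sum_le_sum fun x hx => hball _ (hpK x (hS hx))
      _ = μH[1] (⋃ x ∈ S, γ '' Icc 0 1 ∩ closedBall (p x) (ε / 4)) := by
          refine (measure_biUnion_finset (fun x hx y hy hxy => ?_) fun x _ => ?_).symm
          · refine (closedBall_disjoint_closedBall ?_).mono inter_subset_right inter_subset_right
            linarith [hpp x (hS hx) y (hS hy) (hsep hx hy hxy)]
          · exact ((isCompact_Icc.image_of_continuousOn hγ).isClosed.inter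
              isClosed_closedBall).measurableSet
      _ ≤ μH[1] (γ '' Icc 0 1) := measure_mono (iUnion₂_subset fun _ _ => inter_subset_left)
      _ ≤ ENNReal.ofReal ℓ := hμ
  rw [← ENNReal.ofReal_natCast, ← ENNReal.ofReal_mul (by positivity),
    ENNReal.ofReal_le_ofReal_iff hℓ] at hsum
  linarith

theorem exists_separated_net (hε : 0 < ε) (N : ℕ)
    (hN : ∀ S : Finset X, (S : Set X) ⊆ Γ → (S : Set X).Pairwise (fun x y => ε ≤ dist x y) →
      S.card ≤ N) :
    ∃ S : Finset X, (S : Set X) ⊆ Γ ∧ (S : Set X).Pairwise (fun x y => ε ≤ dist x y) ∧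
      ∀ x ∈ Γ, ∃ y ∈ S, dist x y < ε := by
  classical
  set Q : Set ℕ := {m | ∃ S : Finset X, (S : Set X) ⊆ Γ ∧
    (S : Set X).Pairwise (fun x y => ε ≤ dist x y) ∧ S.card = m} with hQ
  have hne : Q.Nonempty := ⟨0, ∅, by simp⟩
  have hb : BddAbove Q := ⟨N, by rintro _ ⟨S, h1, h2, rfl⟩; exact hN S h1 h2⟩
  obtain ⟨S, hSΓ, hSs, hSc⟩ := Nat.sSup_mem hne hb
  refine ⟨S, hSΓ, hSs, fun x hx => ?_⟩
  by_contra! hc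
  have hxS : x ∉ S := fun h => by have := hc x h; rw [dist_self] at this; linarith
  have : S.card + 1 ∈ Q := by
    refine ⟨insert x S, ?_, ?_, Finset.card_insert_of_notMem hxS⟩
    · rw [Finset.coe_insert]; exact insert_subset hx hSΓ
    · rw [Finset.coe_insert]
      exact hSs.insert fun y hy _ => ⟨hc y hy, dist_comm x y ▸ hc y hy⟩
  have := le_csSup hb this
  omega

/-- Otherwise the `2 * ε`-balls around `A` and those around the rest of `S` would disconnect the
curve. -/
theorem exists_step_of_net (hγ : ContinuousOn γ (Icc 0 1)) (hε : 0 < ε)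
    (hclose : hausdorffEDist Γ (γ '' Icc 0 1) < ENNReal.ofReal (ε / 8)) {S : Finset X}
    (hSΓ : (S : Set X) ⊆ Γ) (hnet : ∀ x ∈ Γ, ∃ y ∈ S, dist x y < ε) {A : Finset X} (hAS : A ⊆ S)
    (hA : A.Nonempty) (hne : A ≠ S) : ∃ u ∈ A, ∃ w ∈ S, w ∉ A ∧ dist u w ≤ 4 * ε := by
  by_contra! hc
  have hp := fun (x : X) (hx : x ∈ Γ) => exists_dist_lt_of_hausdorffEDist_lt_ofReal hx hclose
  choose! p hpK hpx using hp
  set U : Set X := ⋃ a ∈ A, ball a (2 * ε) with hU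
  set W : Set X := ⋃ a ∈ {a | a ∈ S ∧ a ∉ A}, ball a (2 * ε) with hW
  have hconn : IsPreconnected (γ '' Icc 0 1) := isPreconnected_Icc.image _ hγ
  have hcov : γ '' Icc 0 1 ⊆ U ∪ W := fun z hz => by
    rw [hausdorffEDist_comm] at hclose
    obtain ⟨y, hy, hzy⟩ := exists_dist_lt_of_hausdorffEDist_lt_ofReal hz hclose
    obtain ⟨s, hs, hys⟩ := hnet y hy
    have hzs : z ∈ ball s (2 * ε) := by
      rw [mem_ball]; linarith [dist_triangle z y s]
    by_cases hsA : s ∈ A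
    · exact Or.inl (mem_iUnion₂.2 ⟨s, hsA, hzs⟩)
    · exact Or.inr (mem_iUnion₂.2 ⟨s, ⟨hs, hsA⟩, hzs⟩)
  have hmem : ∀ s ∈ S, p s ∈ ball s (2 * ε) := fun s hs => by
    rw [mem_ball, dist_comm]; linarith [hpx s (hSΓ hs)]
  obtain ⟨a, ha⟩ := hA
  obtain ⟨w, hwS, hwA⟩ := Finset.exists_of_ssubset (hAS.ssubset_of_ne hne)
  obtain ⟨z, -, hzU, hzW⟩ := hconn U W (isOpen_biUnion fun _ _ => isOpen_ball)
    (isOpen_biUnion fun _ _ => isOpen_ball) hcov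
    ⟨p a, hpK a (hSΓ (hAS ha)), mem_iUnion₂.2 ⟨a, ha, hmem a (hAS ha)⟩⟩
    ⟨p w, hpK w (hSΓ hwS), mem_iUnion₂.2 ⟨w, ⟨hwS, hwA⟩, hmem w hwS⟩⟩
  obtain ⟨b, hb, hzb⟩ := mem_iUnion₂.1 hzU
  obtain ⟨d, hd, hzd⟩ := mem_iUnion₂.1 hzW
  rw [mem_ball] at hzb hzd
  linarith [hc b hb d hd.1 hd.2, dist_triangle_left b d z]

/-- Walk through a separated net at constant speed: `2 * S.card` steps of size `4 * ε`, where
`S.card * ε ≤ 4 * ℓ`, give the constant `32 * ℓ`. The map is a step function, whence the additive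
error. -/
theorem exists_approximate_parametrization [MeasurableSpace X] [BorelSpace X]
    (hγ : ContinuousOn γ (Icc 0 1)) (hε : 0 < ε)
    (hclose : hausdorffEDist Γ (γ '' Icc 0 1) < ENNReal.ofReal (ε / 8))
    {ℓ : ℝ} (hℓ : 0 ≤ ℓ) (hμ : μH[1] (γ '' Icc 0 1) ≤ ENNReal.ofReal ℓ)
    (hdiam : ∃ x ∈ Γ, ∃ y ∈ Γ, ε ≤ dist x y) :
    ∃ g : ℝ → X, (∀ t, g t ∈ Γ) ∧
      (∀ s ∈ Icc (0 : ℝ) 1, ∀ t ∈ Icc (0 : ℝ) 1,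
        dist (g s) (g t) ≤ 32 * ℓ * |s - t| + 4 * ε) ∧
      ∀ x ∈ Γ, ∃ t ∈ Icc (0 : ℝ) 1, dist (g t) x ≤ ε := by
  have hcard := fun (S : Finset X) hS hsep =>
    card_mul_le_of_separated hγ hε hclose hℓ hμ hdiam (S := S) hS hsep
  obtain ⟨S, hSΓ, hSs, hnet⟩ := exists_separated_net (Γ := Γ) hε ⌊4 * ℓ / ε⌋₊ fun S hS hsep =>
    Nat.le_floor (by rw [le_div_iff₀ hε]; exact hcard S hS hsep)
  obtain ⟨x₀, hx₀, -⟩ := hdiam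
  obtain ⟨y₀, hy₀, -⟩ := hnet x₀ hx₀
  obtain ⟨f, hf, hfS, hfa⟩ := exists_walk_visiting_all (R := fun x y : X => dist x y ≤ 4 * ε)
    (fun x => by rw [dist_self]; positivity) (fun x y h => dist_comm x y ▸ h) S ⟨y₀, hy₀⟩
    fun A hAS hA hne => exists_step_of_net hγ hε hclose hSΓ hnet hAS hA hne
  set M : ℝ := 2 * S.card with hM
  have hM0 : 0 < M := by
    have : (0 : ℝ) < S.card := by exact_mod_cast Finset.card_pos.2 ⟨y₀, hy₀⟩
    positivity
  have hMℓ : 4 * ε * M ≤ 32 * ℓ := by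
    have := hcard S hSΓ hSs
    rw [hM]; linarith
  refine ⟨fun t => f ⌊t * M⌋₊, fun t => hSΓ (hfS _), fun s hs t ht => ?_, fun x hx => ?_⟩
  · calc dist (f ⌊s * M⌋₊) (f ⌊t * M⌋₊)
        ≤ 4 * ε * |(⌊s * M⌋₊ : ℝ) - ⌊t * M⌋₊| := dist_le_mul_abs_sub_of_dist_succ_le hf _ _
      _ ≤ 4 * ε * (|s * M - t * M| + 1) := by
          gcongr
          exact abs_floor_sub_floor_le (mul_nonneg hs.1 hM0.le) (mul_nonneg ht.1 hM0.le)
      _ = 4 * ε * M * |s - t| + 4 * ε := by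
          rw [← sub_mul, abs_mul, abs_of_pos hM0]; ring
      _ ≤ 32 * ℓ * |s - t| + 4 * ε := by gcongr
  · obtain ⟨y, hy, hxy⟩ := hnet x hx
    obtain ⟨i, hi, rfl⟩ := hfa y hy
    have hi' : (i : ℝ) ≤ M := by rw [hM]; exact_mod_cast hi
    refine ⟨i / M, ⟨by positivity, (div_le_one hM0).2 hi'⟩, ?_⟩
    beta_reduce
    rw [div_mul_cancel₀ _ hM0.ne', Nat.floor_natCast, dist_comm]
    exact hxy.le

/-- The maps `g k` need not be continuous, so an ultrafilter limit at every parameter replaces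
Arzelà–Ascoli. The limit is onto because the parameters `τ k` converge along the same ultrafilter.
-/
theorem exists_lipschitz_parametrization_of_approximate {C : ℝ≥0} (hΓ : IsCompact Γ)
    {g : ℕ → ℝ → X} {e : ℕ → ℝ} (he : Tendsto e atTop (𝓝 0)) (hg : ∀ k t, g k t ∈ Γ)
    (hlip : ∀ k, ∀ s ∈ Icc (0 : ℝ) 1, ∀ t ∈ Icc (0 : ℝ) 1,
      dist (g k s) (g k t) ≤ C * |s - t| + e k)
    (hdense : ∀ k, ∀ x ∈ Γ, ∃ t ∈ Icc (0 : ℝ) 1, dist (g k t) x ≤ e k) :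
    ∃ γ : ℝ → X, LipschitzOnWith C γ (Icc 0 1) ∧ Γ = γ '' Icc 0 1 := by
  set U : Ultrafilter ℕ := hyperfilter ℕ with hU
  have hUle : (U : Filter ℕ) ≤ atTop := Nat.hyperfilter_le_atTop
  have heU := he.mono_left hUle
  choose γ hγΓ hγ using fun t => hΓ.exists_tendsto_ultrafilter U (fun k => g k t) fun k => hg k t
  refine ⟨γ, LipschitzOnWith.of_dist_le_mul fun s hs t ht => ?_, Subset.antisymm ?_ ?_⟩
  · have h1 := (hγ s).dist (hγ t)
    have h2 := heU.const_add ((C : ℝ) * |s - t|)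
    rw [add_zero] at h2
    exact le_of_tendsto_of_tendsto' h1 h2 fun k => hlip k s hs t ht
  · intro x hx
    choose τ hτ hτx using fun k => hdense k x hx
    obtain ⟨t, ht, hlim⟩ := isCompact_Icc.exists_tendsto_ultrafilter U τ hτ
    refine ⟨t, ht, ?_⟩
    have h1 : Tendsto (fun k => dist (g k t) x) U (𝓝 0) := by
      refine squeeze_zero (fun _ => dist_nonneg) (fun k => (dist_triangle _ (g k (τ k)) _).trans
        (add_le_add (hlip k t ht (τ k) (hτ k)) (hτx k))) ?_
      have h3 : Tendsto (fun k => |t - τ k|) U (𝓝 0) := by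
        have := (tendsto_const_nhds (x := t)).sub hlim
        rw [sub_self] at this
        simpa using this.abs
      simpa using ((h3.const_mul (C : ℝ)).add heU).add heU
    exact tendsto_nhds_unique (hγ t) (tendsto_iff_dist_tendsto_zero.2 h1)
  · rintro _ ⟨t, -, rfl⟩
    exact hγΓ t

theorem exists_lipschitz_parametrization_of_tendsto [MeasurableSpace X] [BorelSpace X]
    (hΓ : IsCompact Γ) (hne : Γ.Nonempty) {γs : ℕ → ℝ → X}
    (hγs : ∀ j, ContinuousOn (γs j) (Icc 0 1)) {ℓ : ℝ≥0∞} (hℓ : ℓ ≠ ∞)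
    (hμ : ∀ j, μH[1] (γs j '' Icc 0 1) ≤ ℓ)
    (hlim : Tendsto (fun j => hausdorffEDist (γs j '' Icc 0 1) Γ) atTop (𝓝 0)) :
    ∃ (γ : ℝ → X) (C : ℝ≥0), LipschitzOnWith C γ (Icc 0 1) ∧ Γ = γ '' Icc 0 1 := by
  rcases hne.exists_eq_singleton_or_nontrivial with ⟨x, rfl⟩ | ⟨x, hx, y, hy, hxy⟩
  · exact ⟨fun _ => x, 0, LipschitzOnWith.of_dist_le_mul (by simp),
      ((nonempty_Icc.2 zero_le_one).image_const x).symm⟩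
  have hd : 0 < dist x y := dist_pos.2 hxy
  set e : ℕ → ℝ := fun k => dist x y / (k + 1) with he
  have he0 : ∀ k, 0 < e k := fun k => by positivity
  have hel : Tendsto e atTop (𝓝 0) := tendsto_const_div_atTop_nhds_zero_nat (dist x y) |>.comp
    (tendsto_add_atTop_nat 1) |>.congr fun k => by simp [he]
  have happ : ∀ k, ∃ g : ℝ → X, (∀ t, g t ∈ Γ) ∧
      (∀ s ∈ Icc (0 : ℝ) 1, ∀ t ∈ Icc (0 : ℝ) 1,
        dist (g s) (g t) ≤ 32 * ℓ.toReal * |s - t| + 4 * e k) ∧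
      ∀ z ∈ Γ, ∃ t ∈ Icc (0 : ℝ) 1, dist (g t) z ≤ e k := fun k => by
    obtain ⟨j, hj⟩ := (hlim.eventually (gt_mem_nhds (ENNReal.ofReal_pos.2
      (by linarith [he0 k] : 0 < e k / 8)))).exists
    rw [hausdorffEDist_comm] at hj
    exact exists_approximate_parametrization (hγs j) (he0 k) hj ENNReal.toReal_nonneg
      (by rw [ENNReal.ofReal_toReal hℓ]; exact hμ j)
      ⟨x, hx, y, hy, div_le_self hd.le (by simp)⟩
  choose g hg1 hg2 hg3 using happ
  have h4 : Tendsto (fun k => 4 * e k) atTop (𝓝 0) := by simpa using hel.const_mul 4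
  obtain ⟨γ, h⟩ := exists_lipschitz_parametrization_of_approximate
    (C := ⟨32 * ℓ.toReal, by positivity⟩) hΓ h4 hg1 hg2 fun k z hz => by
      obtain ⟨t, ht, h⟩ := hg3 k z hz
      exact ⟨t, ht, h.trans (by linarith [he0 k])⟩
  exact ⟨γ, _, h⟩

end Net

/-! ### Compactness and the direct method -/

/-- Blaschke selection, from compactness of the space of closed subsets of a compact ball. -/
theorem exists_subseq_tendsto_hausdorffEDist {X : Type*} [MetricSpace X] [ProperSpace X]
    {A : ℕ → Set X} (hA : ∀ j, IsCompact (A j)) (hne : ∀ j, (A j).Nonempty) {x₀ : X} {R : ℝ}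
    (hb : ∀ j, A j ⊆ closedBall x₀ R) :
    ∃ φ : ℕ → ℕ, StrictMono φ ∧ ∃ B : Set X, IsCompact B ∧ B.Nonempty ∧
      Tendsto (fun j => hausdorffEDist (A (φ j)) B) atTop (𝓝 0) := by
  have : CompactSpace (closedBall x₀ R) := isCompact_iff_compactSpace.1 (isCompact_closedBall x₀ R)
  set A' : ℕ → TopologicalSpace.Closeds (closedBall x₀ R) := fun j =>
    ⟨Subtype.val ⁻¹' A j, (hA j).isClosed.preimage continuous_subtype_val⟩ with hA'
  have himg : ∀ j, Subtype.val '' (A' j : Set (closedBall x₀ R)) = A j := fun j => by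
    change Subtype.val '' (Subtype.val ⁻¹' A j) = A j
    rw [Subtype.image_preimage_coe, inter_eq_right.2 (hb j)]
  obtain ⟨B, φ, hφ, hlim⟩ := CompactSpace.tendsto_subseq A'
  have hlim' : Tendsto (fun j => hausdorffEDist (A (φ j))
      (Subtype.val '' (B : Set (closedBall x₀ R)))) atTop (𝓝 0) := by
    rw [tendsto_iff_edist_tendsto_0] at hlim
    refine hlim.congr fun j => ?_
    rw [TopologicalSpace.Closeds.edist_eq, ← hausdorffEDist_image isometry_subtype_coe]
    simp only [Function.comp_apply, himg]
  refine ⟨φ, hφ, Subtype.val '' (B : Set (closedBall x₀ R)),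
    B.isClosed.isCompact.image continuous_subtype_val, ?_, hlim'⟩
  obtain ⟨j, hj⟩ := (hlim'.eventually (gt_mem_nhds ENNReal.zero_lt_top)).exists
  exact nonempty_of_hausdorffEDist_ne_top (hne _) hj.ne

theorem mem_cthickening_of_tendsto {X : Type*} [PseudoEMetricSpace X] {A : ℕ → Set X}
    {B : Set X} {r : ℕ → ℝ} {ρ : ℝ} {x : X} (hr : Tendsto r atTop (𝓝 ρ))
    (hlim : Tendsto (fun j => hausdorffEDist (A j) B) atTop (𝓝 0))
    (hx : ∀ j, x ∈ cthickening (r j) (A j)) : x ∈ cthickening ρ B := by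
  rw [mem_cthickening_iff]
  have h1 : Tendsto (fun j => ENNReal.ofReal (r j) + hausdorffEDist (A j) B) atTop
      (𝓝 (ENNReal.ofReal ρ)) := by
    simpa using (ENNReal.tendsto_ofReal hr).add hlim
  refine ge_of_tendsto' h1 fun j => ?_
  exact infEDist_le_infEDist_add_hausdorffEDist.trans
    (add_le_add_left (mem_cthickening_iff.1 (hx j)) _)

section Curves

variable {n : ℕ}

theorem IsRectifiableCurve.isCompact {Γ : Set (EuclideanSpace ℝ (Fin n))}
    (h : IsRectifiableCurve Γ) : IsCompact Γ := by
  obtain ⟨γ, K, hγ, rfl⟩ := h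
  exact isCompact_Icc.image_of_continuousOn hγ.continuousOn

theorem IsRectifiableCurve.nonempty {Γ : Set (EuclideanSpace ℝ (Fin n))}
    (h : IsRectifiableCurve Γ) : Γ.Nonempty := by
  obtain ⟨γ, K, hγ, rfl⟩ := h
  exact (nonempty_Icc.2 zero_le_one).image γ

theorem IsRectifiableCurve.isPreconnected {Γ : Set (EuclideanSpace ℝ (Fin n))}
    (h : IsRectifiableCurve Γ) : IsPreconnected Γ := by
  obtain ⟨γ, K, hγ, rfl⟩ := h
  exact isPreconnected_Icc.image γ hγ.continuousOn

theorem IsRectifiableCurve.hausdorffMeasure_lt_top {Γ : Set (EuclideanSpace ℝ (Fin n))}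
    (h : IsRectifiableCurve Γ) : μH[1] Γ < ∞ := by
  obtain ⟨γ, K, hγ, rfl⟩ := h
  refine (hγ.hausdorffMeasure_image_le zero_le_one).trans_lt ?_
  rw [hausdorffMeasure_real, Real.volume_Icc]
  exact ENNReal.mul_lt_top (by simp) (by simp)

theorem isRectifiableCurve_singleton (x : EuclideanSpace ℝ (Fin n)) :
    IsRectifiableCurve {x} :=
  ⟨fun _ => x, 0, LipschitzOnWith.of_dist_le_mul (by simp),
    ((nonempty_Icc.2 zero_le_one).image_const x).symm⟩

theorem IsRectifiableCurve.exists_subseq_tendsto {Γ : ℕ → Set (EuclideanSpace ℝ (Fin n))}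
    (hΓ : ∀ j, IsRectifiableCurve (Γ j)) {ℓ : ℝ≥0∞} (hℓ : ℓ ≠ ∞) (hμ : ∀ j, μH[1] (Γ j) ≤ ℓ)
    {x₀ : EuclideanSpace ℝ (Fin n)} {R : ℝ} (hx₀ : ∀ j, x₀ ∈ cthickening R (Γ j)) :
    ∃ φ : ℕ → ℕ, StrictMono φ ∧ ∃ Γ₀ : Set (EuclideanSpace ℝ (Fin n)), IsRectifiableCurve Γ₀ ∧
      Tendsto (fun j => hausdorffEDist (Γ (φ j)) Γ₀) atTop (𝓝 0) ∧
      μH[1] Γ₀ ≤ liminf (fun j => μH[1] (Γ (φ j))) atTop := by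
  -- Each curve passes near `x₀` and has diameter at most `ℓ`; `max R 0 + 1` allows negative `R` and
  -- gives a strict inequality.
  have hb : ∀ j, Γ j ⊆ closedBall x₀ (max R 0 + 1 + ℓ.toReal) := fun j y hy => by
    obtain ⟨z, hz, hzx⟩ := infEDist_lt_iff.1 ((mem_cthickening_iff.1 (hx₀ j)).trans_lt
      ((ENNReal.ofReal_lt_ofReal_iff (by positivity)).2
        ((le_max_left R 0).trans_lt (lt_add_one _))))
    have h1 := (edist_le_hausdorffMeasure_of_isPreconnected (hΓ j).isPreconnected hy hz).trans
      (hμ j)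
    rw [edist_dist, ENNReal.ofReal_le_iff_le_toReal hℓ] at h1
    rw [edist_dist, ENNReal.ofReal_lt_ofReal_iff (by positivity), dist_comm] at hzx
    rw [mem_closedBall]
    linarith [dist_triangle y z x₀]
  obtain ⟨φ, hφ, B, hB, hBne, hlim⟩ := exists_subseq_tendsto_hausdorffEDist
    (fun j => (hΓ j).isCompact) (fun j => (hΓ j).nonempty) hb
  choose γ K hγ hγΓ using hΓ
  obtain rfl : Γ = fun j => γ j '' Icc 0 1 := funext hγΓ
  obtain ⟨γ₀, C, hγ₀, rfl⟩ := exists_lipschitz_parametrization_of_tendsto hB hBne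
    (γs := fun j => γ (φ j)) (fun j => (hγ _).continuousOn) hℓ (fun j => hμ _) hlim
  exact ⟨φ, hφ, _, ⟨γ₀, C, hγ₀, rfl⟩, hlim,
    hausdorffMeasure_le_liminf_of_tendsto_hausdorffEDist hγ₀ (fun j => (hγ _).continuousOn) hlim⟩

theorem maxDistInf_le {E Γ : Set (EuclideanSpace ℝ (Fin n))} {r : ℝ} (hΓ : IsRectifiableCurve Γ)
    (h : E ⊆ cthickening r Γ) : maxDistInf E r ≤ μH[1] Γ :=
  sInf_le ⟨Γ, hΓ, h, rfl⟩

theorem travelingSalesmanInf_le {E Γ : Set (EuclideanSpace ℝ (Fin n))}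
    (hΓ : IsRectifiableCurve Γ) (h : E ⊆ Γ) : travelingSalesmanInf E ≤ μH[1] Γ :=
  sInf_le ⟨Γ, hΓ, h, rfl⟩

theorem maxDistInf_cthickening_le_travelingSalesmanInf (E : Set (EuclideanSpace ℝ (Fin n)))
    (r : ℝ) : maxDistInf (cthickening r E) r ≤ travelingSalesmanInf E := by
  refine le_sInf ?_
  rintro _ ⟨Γ, hΓ, hE, rfl⟩
  exact maxDistInf_le hΓ (cthickening_subset_of_subset r hE)

theorem exists_isMaxDistMinimizer {E : Set (EuclideanSpace ℝ (Fin n))} (hne : E.Nonempty) {r : ℝ}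
    (hE : ∃ Γ, IsRectifiableCurve Γ ∧ E ⊆ cthickening r Γ) : ∃ Γ, IsMaxDistMinimizer E r Γ := by
  obtain ⟨Γ₁, hΓ₁, hE₁⟩ := hE
  obtain ⟨x₀, hx₀⟩ := hne
  obtain ⟨u, hu, hulim, humem⟩ := exists_seq_tendsto_sInf
    (S := {ℓ | ∃ Γ : Set (EuclideanSpace ℝ (Fin n)),
      IsRectifiableCurve Γ ∧ E ⊆ cthickening r Γ ∧ ℓ = μH[1] Γ})
    ⟨_, Γ₁, hΓ₁, hE₁, rfl⟩ (OrderBot.bddBelow _)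
  choose Γ hΓ hEΓ huΓ using humem
  obtain ⟨φ, hφ, Γ₀, hΓ₀, hlim, hle⟩ := IsRectifiableCurve.exists_subseq_tendsto hΓ
    (hΓ 0).hausdorffMeasure_lt_top.ne (fun j => by rw [← huΓ, ← huΓ]; exact hu (Nat.zero_le j))
    (fun j => hEΓ j hx₀)
  have hEΓ₀ : E ⊆ cthickening r Γ₀ := fun x hx =>
    mem_cthickening_of_tendsto tendsto_const_nhds hlim fun j => hEΓ _ hx
  refine ⟨Γ₀, hΓ₀, hEΓ₀, le_antisymm (hle.trans (le_of_eq ?_)) (maxDistInf_le hΓ₀ hEΓ₀)⟩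
  refine Tendsto.liminf_eq ((hulim.comp hφ.tendsto_atTop).congr fun j => huΓ _)

end Curves

theorem theorem2p1 (n : ℕ) (E : Set (EuclideanSpace ℝ (Fin n)))
    (hE : ∃ Γ : Set (EuclideanSpace ℝ (Fin n)), IsRectifiableCurve Γ ∧ E ⊆ Γ)
    (r : ℕ → ℝ) (hr_pos : ∀ j, 0 < r j) (hr_lim : Tendsto r atTop (𝓝 0)) :
    ∃ Γ : ℕ → Set (EuclideanSpace ℝ (Fin n)),
      (∀ j, IsMaxDistMinimizer (cthickening (r j) E) (r j) (Γ j)) ∧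
      Tendsto (fun j => μH[1] (Γ j)) atTop (𝓝 (travelingSalesmanInf E)) ∧
      ∀ ψ : ℕ → ℕ, StrictMono ψ →
        ∃ φ : ℕ → ℕ, StrictMono φ ∧
          ∃ Γ₀ : Set (EuclideanSpace ℝ (Fin n)),
            IsRectifiableCurve Γ₀ ∧ E ⊆ Γ₀ ∧
            Tendsto (fun j => hausdorffEDist (Γ (ψ (φ j))) Γ₀) atTop (𝓝 0) ∧
            μH[1] Γ₀ = travelingSalesmanInf E := by
  -- For empty `E` no point anchors the minimizers, which could escape to infinity, so a constant
  -- sequence is chosen.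
  rcases E.eq_empty_or_nonempty with rfl | ⟨x₀, hx₀⟩
  · have := Measure.nullSingletonClass_hausdorff (EuclideanSpace ℝ (Fin n)) zero_lt_one
    have hpt := isRectifiableCurve_singleton (0 : EuclideanSpace ℝ (Fin n))
    have hμ : μH[1] {(0 : EuclideanSpace ℝ (Fin n))} = 0 := measure_singleton _
    have hT : travelingSalesmanInf (∅ : Set (EuclideanSpace ℝ (Fin n))) = 0 :=
      le_antisymm ((travelingSalesmanInf_le hpt (empty_subset _)).trans hμ.le) zero_le
    refine ⟨fun _ => {0}, fun j => ⟨hpt, by simp, ?_⟩, by simp only [hμ, hT, tendsto_const_nhds],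
      fun ψ _ => ⟨id, strictMono_id, {0}, hpt, empty_subset _, by simp, by rw [hμ, hT]⟩⟩
    refine le_antisymm (hμ.le.trans zero_le) (maxDistInf_le hpt (by simp))
  · obtain ⟨Γ₁, hΓ₁, hE₁⟩ := hE
    have hmin : ∀ j, ∃ Γ, IsMaxDistMinimizer (cthickening (r j) E) (r j) Γ := fun j =>
      exists_isMaxDistMinimizer ⟨x₀, self_subset_cthickening E hx₀⟩
        ⟨Γ₁, hΓ₁, cthickening_subset_of_subset _ hE₁⟩
    choose Γ hΓ using hmin
    have hle : ∀ j, μH[1] (Γ j) ≤ travelingSalesmanInf E := fun j =>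
      (hΓ j).2.2.trans_le (maxDistInf_cthickening_le_travelingSalesmanInf E (r j))
    have hT : travelingSalesmanInf E ≠ ∞ :=
      ((travelingSalesmanInf_le hΓ₁ hE₁).trans_lt hΓ₁.hausdorffMeasure_lt_top).ne
    have hEj : ∀ j, E ⊆ cthickening (r j) (Γ j) := fun j =>
      (self_subset_cthickening E).trans (hΓ j).2.1
    obtain ⟨R, hR⟩ := hr_lim.bddAbove_range
    -- Not restricted to strictly monotone `ψ`, so that it also serves `tendsto_of_subseq_tendsto`
    -- for convergence along the whole sequence.
    have key : ∀ ψ : ℕ → ℕ, Tendsto ψ atTop atTop → ∃ φ : ℕ → ℕ, StrictMono φ ∧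
        ∃ Γ₀ : Set (EuclideanSpace ℝ (Fin n)), IsRectifiableCurve Γ₀ ∧ E ⊆ Γ₀ ∧
          Tendsto (fun j => hausdorffEDist (Γ (ψ (φ j))) Γ₀) atTop (𝓝 0) ∧
          μH[1] Γ₀ = travelingSalesmanInf E ∧
          Tendsto (fun j => μH[1] (Γ (ψ (φ j)))) atTop (𝓝 (travelingSalesmanInf E)) := by
      intro ψ hψ
      obtain ⟨φ, hφ, Γ₀, hΓ₀, hlim, hlsc⟩ := IsRectifiableCurve.exists_subseq_tendsto
        (Γ := fun j => Γ (ψ j)) (fun j => (hΓ _).1) hT (fun j => hle _) (x₀ := x₀) (R := R)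
        fun j => cthickening_mono (hR ⟨_, rfl⟩) _ (hEj _ hx₀)
      have hEΓ₀ : E ⊆ Γ₀ := fun x hx => by
        have h0 := mem_cthickening_of_tendsto
          (hr_lim.comp (hψ.comp hφ.tendsto_atTop)) hlim fun j => hEj _ hx
        rwa [cthickening_zero, hΓ₀.isCompact.isClosed.closure_eq] at h0
      have h1 := travelingSalesmanInf_le hΓ₀ hEΓ₀
      have h2 : limsup (fun j => μH[1] (Γ (ψ (φ j)))) atTop ≤ travelingSalesmanInf E :=
        limsup_le_of_le (by isBoundedDefault) (Eventually.of_forall fun j => hle _)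
      exact ⟨φ, hφ, Γ₀, hΓ₀, hEΓ₀, hlim,
        le_antisymm (hlsc.trans ((liminf_le_limsup).trans h2)) h1,
        tendsto_of_le_liminf_of_limsup_le (h1.trans hlsc) h2⟩
    refine ⟨Γ, hΓ, tendsto_of_subseq_tendsto fun ψ hψ => ?_, fun ψ hψ => ?_⟩
    · obtain ⟨φ, -, -, -, -, -, -, h⟩ := key ψ hψ
      exact ⟨φ, h⟩
    · obtain ⟨φ, hφ, Γ₀, h1, h2, h3, h4, -⟩ := key ψ hψ.tendsto_atTop
      exact ⟨φ, hφ, Γ₀, h1, h2, h3, h4⟩
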